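/- Let $n \ge 1$. A block-parallel update mode of size $n$ is a partitioned order of $\{0,\dots,n-1\}$, i.e. a finite set $\mu=\{S_1,\dots,S_s\}$ of nonempty sequences (o-blocks) $S_k=(i^k_0,\dots,i^k_{n_k-1})$ such that every element of $\{0,\dots,n-1\}$ appears in exactly one $S_k$, and exactly once in it; $\mathsf{BP}_n$ is the set of these modes. For $\mu\in\mathsf{BP}_n$ let $\ell=\mathrm{lcm}(n_1,\dots,n_s)$ and let $\varphi(\mu)=(W_0,\dots,W_{\ell-1})$ with $W_t=\{\, i^k_{t \bmod n_k} \mid 1\le k\le s \,\}$. Write $\mu\equiv_0\mu'$ when $\varphi(\mu)=\varphi(\mu')$, and $\mu\equiv_\star\mu'$ when $\varphi(\mu)$ is the circular shift of $\varphi(\mu')$ of some order $i\in\{0,\dots,|\varphi(\mu')|-1\}$; both are equivalence relations, and $\equiv_0$ refines $\equiv_\star$. Put $\mathsf{BP}_n^0=\mathsf{BP}_n/\!\equiv_0$ and $\mathsf{BP}_n^\star=\mathsf{BP}_n/\!\equiv_\star$. For an integer partition $p$ of $n$ let $d(p)$ be its largest part, $m(p,j)$ the multiplicity of the part $j$ in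 $p$, and $\mathrm{lcm}(p)=\mathrm{lcm}\{\,j\in\{1,\dots,d(p)\} \mid m(p,j)\ge 1\,\}$. The mode $\mu$ is generated from the partition of $n$ whose parts are the sizes $n_1,\dots,n_s$ of its o-blocks. **Theorem.** For every $n\ge 1$, $$|\mathsf{BP}_n^\star|=\sum_{p}\frac{n!}{\prod_{j=1}^{d(p)}\bigl(m(p,j)!\bigr)^j}\cdot\frac{1}{\mathrm{lcm}(p)},$$ where $p$ ranges over the integer partitions of $n$. Moreover, all modes in one $\equiv_\star$-class are generated from the same partition $p$ of $n$, and this class contains exactly $\mathrm{lcm}(p)$ classes of $\equiv_0$. -/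

import Mathlib

open scoped Nat

/-- `IsPartitionedOrder μ`: the finite set `μ` of sequences over `{0, …, n - 1}` is a partitioned
order: every sequence (o-block) is nonempty and without repetition, and every automaton appears in
exactly one o-block. -/
def IsPartitionedOrder {n : ℕ} (μ : Finset (List (Fin n))) : Prop :=
  (∀ S ∈ μ, S ≠ [] ∧ S.Nodup) ∧ ∀ a : Fin n, ∃! S, S ∈ μ ∧ a ∈ S

/-- The set of block-parallel update modes of size `n`. -/
def BP (n : ℕ) : Type :=
  {μ : Finset (List (Fin n)) // IsPartitionedOrder μ}

namespace BP

variable {n : ℕ}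

/-- The number of substeps: the least common multiple of the sizes of the o-blocks. -/
def numSubsteps (μ : BP n) : ℕ :=
  μ.1.lcm List.length

/-- The block `W_t` of automata updated at substep `t`: those at position `t mod |S|` in some
o-block `S`. -/
def block (μ : BP n) (t : ℕ) : Finset (Fin n) :=
  Finset.univ.filter fun a => ∃ S ∈ μ.1, S[t % S.length]? = some a

/-- The conversion of a block-parallel update mode into its finite sequence of blocks. -/
def phi (μ : BP n) : List (Finset (Fin n)) :=
  (List.range μ.numSubsteps).map μ.block

/-- Equality of the sequences of blocks. -/
def Equiv₀ (μ ν : BP n) : Prop :=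
  μ.phi = ν.phi

/-- Equality of the sequences of blocks up to a circular shift. -/
def EquivStar (μ ν : BP n) : Prop :=
  ∃ i < ν.phi.length, μ.phi = ν.phi.rotate i

theorem length_phi (μ : BP n) : μ.phi.length = μ.numSubsteps := by
  simp [phi]

theorem numSubsteps_pos (μ : BP n) : 0 < μ.numSubsteps := by
  refine Nat.pos_of_ne_zero fun h => ?_
  obtain ⟨S, hS, h0⟩ := Finset.lcm_eq_zero_iff.1 h
  exact (μ.2.1 S hS).1 (List.length_eq_zero_iff.1 h0)

theorem equivStar_iff_isRotated (μ ν : BP n) : EquivStar μ ν ↔ ν.phi ~r μ.phi := by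
  constructor
  · rintro ⟨i, -, h⟩
    exact ⟨i, h.symm⟩
  · rintro ⟨i, h⟩
    refine ⟨i % ν.phi.length, Nat.mod_lt _ ?_, ?_⟩
    · rw [length_phi]
      exact ν.numSubsteps_pos
    · rw [List.rotate_mod, h]

/-- Equality of the sequences of blocks, as an equivalence relation. -/
def setoid₀ (n : ℕ) : Setoid (BP n) where
  r := Equiv₀
  iseqv := ⟨fun _ => rfl, fun h => Eq.symm h, fun h k => Eq.trans h k⟩

/-- Equality of the sequences of blocks up to a circular shift, as an equivalence relation. -/
def setoidStar (n : ℕ) : Setoid (BP n) where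
  r := EquivStar
  iseqv :=
    ⟨fun μ => (equivStar_iff_isRotated μ μ).2 (List.IsRotated.refl _),
      fun {μ ν} h =>
        (equivStar_iff_isRotated ν μ).2 ((equivStar_iff_isRotated μ ν).1 h).symm,
      fun {μ ν ξ} h k =>
        (equivStar_iff_isRotated μ ξ).2
          (((equivStar_iff_isRotated ν ξ).1 k).trans ((equivStar_iff_isRotated μ ν).1 h))⟩

theorem EquivStar.of_equiv₀ {μ ν : BP n} (h : Equiv₀ μ ν) : EquivStar μ ν :=
  (equivStar_iff_isRotated μ ν).2 (by rw [show μ.phi = ν.phi from h])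

theorem sum_length (μ : BP n) : (μ.1.val.map List.length).sum = n := by
  have hdisj : (μ.1 : Set (List (Fin n))).PairwiseDisjoint List.toFinset := by
    intro S hS T hT hne
    refine Finset.disjoint_left.2 fun a ha hb => hne ?_
    exact (μ.2.2 a).unique ⟨hS, List.mem_toFinset.1 ha⟩ ⟨hT, List.mem_toFinset.1 hb⟩
  have huniv : μ.1.biUnion List.toFinset = Finset.univ := by
    ext a
    obtain ⟨S, hS, -⟩ := μ.2.2 a
    simpa using ⟨S, hS⟩
  have hcard := Finset.card_biUnion hdisj
  rw [huniv, Finset.card_univ, Fintype.card_fin] at hcard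
  calc (μ.1.val.map List.length).sum = ∑ S ∈ μ.1, S.length := rfl
    _ = ∑ S ∈ μ.1, S.toFinset.card :=
      Finset.sum_congr rfl fun S hS => (List.toFinset_card_of_nodup (μ.2.1 S hS).2).symm
    _ = n := hcard.symm

/-- The integer partition of `n` from which `μ` is generated: its parts are the sizes of the
o-blocks of `μ`, with multiplicity. -/
def partition (μ : BP n) : n.Partition where
  parts := μ.1.val.map List.length
  parts_pos := by
    intro j hj
    obtain ⟨S, hS, rfl⟩ := Multiset.mem_map.1 hj
    exact List.length_pos_of_ne_nil (μ.2.1 S hS).1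
  parts_sum := μ.sum_length

end BP

/-- The set of block-parallel update modes up to equality of their sequences of blocks. -/
def BPZero (n : ℕ) : Type :=
  Quotient (BP.setoid₀ n)

/-- The set of block-parallel update modes up to equality of their sequences of blocks
modulo circular shifts. -/
def BPStar (n : ℕ) : Type :=
  Quotient (BP.setoidStar n)

/-- The class in `BPStar n` of a block-parallel update mode. -/
def BP.toStar {n : ℕ} (μ : BP n) : BPStar n :=
  Quotient.mk (BP.setoidStar n) μ

/-- The class in `BPStar n` that contains a given class of `BPZero n`. -/
def BPZero.toStar {n : ℕ} (c : BPZero n) : BPStar n :=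
  Quotient.lift (s := BP.setoid₀ n) BP.toStar
    (fun _ _ h => Quotient.sound (s := BP.setoidStar n) (BP.EquivStar.of_equiv₀ h)) c

namespace Nat.Partition

variable {n : ℕ}

/-- The multiplicity `m(p, j)` of the part size `j` in `p`. -/
def mult (p : n.Partition) (j : ℕ) : ℕ :=
  p.parts.count j

/-- The maximal part size `d(p)` of `p`. -/
def maxPart (p : n.Partition) : ℕ :=
  p.parts.sup

/-- The least common multiple of the part sizes of `p`. -/
def lcmParts (p : n.Partition) : ℕ :=
  ((Finset.Icc 1 p.maxPart).filter fun j => 1 ≤ p.mult j).lcm id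

end Nat.Partition

/-! An automaton `a` at position `r` of an o-block of size `j` lies in `W_t` exactly when `t ≡ r`
mod `j`. The sequence of blocks thus carries the same information as the placement `a ↦ (j, r)`, and
rotating it by `i` adds `i` to every position, modulo the size, leaving the sizes alone
(`phi_eq_rotate_iff`). Hence the partition is invariant, and the `≡₀`-classes for `p` correspond to
the maps whose fibre over `(j, r)`, `r < j`, has `m(p, j)` elements and which take no other value;
orbit counting under permutations gives `n! / ∏ (m(p, j)!)^j` of them (`card_isPlacement_mul`). Two
shifts of one placement agree exactly when they are congruent modulo every size, that is, modulo
`lcm(p)`. So each `≡⋆`-class consists of `lcm(p)` classes of `≡₀` (`card_toStar_fiber`), and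
division gives the formula. -/

/-! ### Maps with prescribed fibre sizes -/

/-- The number of maps with prescribed fibre sizes `m`, multiplied by the factorials of the
prescribed sizes. -/
theorem card_fiber_eq_mul_prod_factorial {α β : Type*} [Fintype α] [DecidableEq α] [DecidableEq β]
    (m : β → ℕ) (T : Finset β) (hT : ∀ b ∉ T, m b = 0) (hm : ∑ b ∈ T, m b = Fintype.card α) :
    Nat.card {f : α → β // ∀ b, Fintype.card {a // f a = b} = m b} * ∏ b ∈ T, (m b)! =
      (Fintype.card α)! := by
  obtain ⟨f₀, hf₀⟩ : ∃ f : α → β, ∀ b, Fintype.card {a // f a = b} = m b := by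
    have hc : Fintype.card α = Fintype.card (Σ b : T, Fin (m b)) := by
      simp [← hm, Finset.sum_attach T m]
    let e := Fintype.equivOfCardEq hc
    refine ⟨fun a => (e a).1, fun b => ?_⟩
    by_cases hb : b ∈ T
    · have e1 : {a // ((e a).1 : β) = b} ≃ {x : Σ b : T, Fin (m b) // x.1 = ⟨b, hb⟩} :=
        e.subtypeEquiv fun a => by simp [Subtype.ext_iff]
      rw [Fintype.card_congr (e1.trans (Equiv.sigmaSubtype (⟨b, hb⟩ : T))), Fintype.card_fin]
    · rw [hT b hb, Fintype.card_eq_zero_iff]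
      exact ⟨fun a => hb (a.2 ▸ (e a.1).1.2)⟩
  have hstab : Nat.card {g : Equiv.Perm α // f₀ ∘ g = f₀} = ∏ b ∈ T, (m b)! := by
    rw [Nat.card_eq_fintype_card, DomMulAct.stabilizer_card']
    simp only [hf₀]
    refine Finset.prod_subset (fun b hb => ?_) fun b _ hb => ?_
    · obtain ⟨a, -, rfl⟩ := Finset.mem_image.1 hb
      by_contra h
      have := (hf₀ (f₀ a)).trans (hT _ h)
      rw [Fintype.card_eq_zero_iff] at this
      exact this.false ⟨a, rfl⟩
    · rw [← hf₀ b, Fintype.card_eq_zero_iff.2 ⟨fun a => hb ?_⟩, Nat.factorial_zero]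
      exact Finset.mem_image.2 ⟨a.1, Finset.mem_univ _, a.2⟩
  -- Orbit counting: permutations act transitively on these maps, and each fibre of `F` is a coset
  -- of the stabilizer of `f₀`.
  let F : Equiv.Perm α → {f : α → β // ∀ b, Fintype.card {a // f a = b} = m b} := fun g =>
    ⟨f₀ ∘ g, fun b => by
      rw [← hf₀ b]
      exact Fintype.card_congr (g.subtypeEquiv fun a => Iff.rfl)⟩
  have hF : Function.Surjective F := by
    rintro ⟨f, hf⟩
    let e : ∀ b, {a // f a = b} ≃ {a // f₀ a = b} := fun b =>
      Fintype.equivOfCardEq ((hf b).trans (hf₀ b).symm)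
    refine ⟨(Equiv.sigmaFiberEquiv f).symm.trans
      ((Equiv.sigmaCongrRight e).trans (Equiv.sigmaFiberEquiv f₀)), Subtype.ext (funext fun a => ?_)⟩
    exact (e (f a) ⟨a, rfl⟩).2
  have hfib : ∀ f, Nat.card {g // F g = f} = ∏ b ∈ T, (m b)! := by
    intro f
    obtain ⟨g₀, rfl⟩ := hF f
    rw [← hstab]
    refine Nat.card_congr ((Equiv.mulRight g₀⁻¹).subtypeEquiv fun g => ?_)
    constructor
    · intro h
      have h' : f₀ ∘ g = f₀ ∘ g₀ := congrArg Subtype.val h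
      ext a
      simpa using congrFun h' (g₀⁻¹ a)
    · intro h
      refine Subtype.ext (funext fun a => ?_)
      simpa [F] using congrFun h (g₀ a)
  have : Finite {f : α → β // ∀ b, Fintype.card {a // f a = b} = m b} := Finite.of_surjective F hF
  have := Fintype.ofFinite {f : α → β // ∀ b, Fintype.card {a // f a = b} = m b}
  rw [← Fintype.card_perm, ← Nat.card_eq_fintype_card (α := Equiv.Perm α),
    ← Nat.card_congr (Equiv.sigmaFiberEquiv F), Nat.card_sigma,
    Finset.sum_congr rfl fun f _ => hfib f]
  simp

/-! ### Placements for a partition and their cyclic shifts -/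

namespace Nat.Partition

variable {n : ℕ}

theorem mult_eq_zero {p : n.Partition} {j : ℕ} (h : j ∉ Finset.Icc 1 p.maxPart) : p.mult j = 0 := by
  refine Multiset.count_eq_zero.2 fun hj => h ?_
  exact Finset.mem_Icc.2 ⟨p.parts_pos hj, Multiset.le_sup hj⟩

theorem lcmParts_dvd_iff {p : n.Partition} {k : ℕ} : p.lcmParts ∣ k ↔ ∀ j ∈ p.parts, j ∣ k := by
  rw [lcmParts, Finset.lcm_dvd_iff]
  constructor
  · intro h j hj
    exact h j (Finset.mem_filter.2 ⟨Finset.mem_Icc.2 ⟨p.parts_pos hj, Multiset.le_sup hj⟩,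
      Multiset.one_le_count_iff_mem.2 hj⟩)
  · intro h j hj
    exact h j (Multiset.one_le_count_iff_mem.1 (Finset.mem_filter.1 hj).2)

theorem sum_mult_mul (p : n.Partition) : ∑ j ∈ Finset.Icc 1 p.maxPart, p.mult j * j = n := by
  conv_rhs => rw [← p.parts_sum, Finset.sum_multiset_count]
  symm
  refine Finset.sum_subset (fun j hj => ?_) fun j _ hj => ?_
  · rw [Multiset.mem_toFinset] at hj
    exact Finset.mem_Icc.2 ⟨p.parts_pos hj, Multiset.le_sup hj⟩
  · rw [Multiset.mem_toFinset] at hj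
    simp [hj]

/-- A map sending every automaton to a pair (size, position) is a placement for `p` when, for every
part `j` of `p`, each of the `j` positions is taken by as many automata as the multiplicity of `j`,
and no other pair is a value. -/
def IsPlacement (p : n.Partition) (f : Fin n → ℕ × ℕ) : Prop :=
  ∀ b : ℕ × ℕ, Fintype.card {a // f a = b} = if b.2 < b.1 then p.mult b.1 else 0

theorem card_isPlacement_mul (p : n.Partition) :
    Nat.card {f : Fin n → ℕ × ℕ // p.IsPlacement f} *
      ∏ j ∈ Finset.Icc 1 p.maxPart, (p.mult j)! ^ j = n ! := by
  -- The box contains every pair `(j, r)` of nonzero multiplicity; its pairs with `r ≥ j` contribute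
  -- `0! = 1`.
  have key := card_fiber_eq_mul_prod_factorial (α := Fin n)
    (fun b : ℕ × ℕ => if b.2 < b.1 then p.mult b.1 else 0)
    (Finset.Icc 1 p.maxPart ×ˢ Finset.range p.maxPart) ?_ ?_
  · rw [Fintype.card_fin, Finset.prod_product] at key
    rw [← key]
    congr 1
    refine Finset.prod_congr rfl fun j hj => ?_
    rw [← Finset.prod_subset (Finset.range_mono (Finset.mem_Icc.1 hj).2)]
    · rw [Finset.prod_congr rfl (g := fun _ => (p.mult j)!), Finset.prod_const, Finset.card_range]
      intro r hr
      rw [if_pos (Finset.mem_range.1 hr)]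
    · intro r _ hr
      rw [if_neg (by simpa using hr), Nat.factorial_zero]
  · rintro ⟨j, r⟩ h
    dsimp only
    split_ifs with hr
    · refine mult_eq_zero fun hj => h ?_
      exact Finset.mem_product.2 ⟨hj, Finset.mem_range.2 (hr.trans_le (Finset.mem_Icc.1 hj).2)⟩
    · rfl
  · rw [Fintype.card_fin, Finset.sum_product]
    conv_rhs => rw [← p.sum_mult_mul]
    refine Finset.sum_congr rfl fun j hj => ?_
    rw [← Finset.sum_subset (Finset.range_mono (Finset.mem_Icc.1 hj).2)]
    · rw [Finset.sum_congr rfl (g := fun _ => p.mult j), Finset.sum_const, Finset.card_range,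
        smul_eq_mul, mul_comm]
      intro r hr
      rw [if_pos (Finset.mem_range.1 hr)]
    · intro r _ hr
      rw [if_neg (by simpa using hr)]

theorem IsPlacement.snd_lt_fst {p : n.Partition} {f : Fin n → ℕ × ℕ} (h : p.IsPlacement f)
    (a : Fin n) : (f a).2 < (f a).1 := by
  by_contra hlt
  have := h (f a)
  rw [if_neg hlt, Fintype.card_eq_zero_iff] at this
  exact this.false ⟨a, rfl⟩

/-- The multiplicity of `j > 0` is the size of the fibre over `(j, 0)`; the size `0` has no
positions but is never a part. -/
theorem IsPlacement.unique {p q : n.Partition} {f : Fin n → ℕ × ℕ} (hp : p.IsPlacement f)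
    (hq : q.IsPlacement f) : p = q := by
  refine Nat.Partition.ext (Multiset.ext.2 fun j => ?_)
  rcases Nat.eq_zero_or_pos j with rfl | hj
  · exact (mult_eq_zero (p := p) (by simp)).trans (mult_eq_zero (p := q) (by simp)).symm
  · have := (hp (j, 0)).symm.trans (hq (j, 0))
    simp only [if_pos hj] at this
    exact this

/-- Moving a pair (size, position) forward by `i` positions, cyclically. -/
def shiftPos (i : ℕ) (b : ℕ × ℕ) : ℕ × ℕ :=
  (b.1, (b.2 + i) % b.1)

theorem IsPlacement.shiftPos {p : n.Partition} {f : Fin n → ℕ × ℕ} (h : p.IsPlacement f) (i : ℕ) :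
    p.IsPlacement (Nat.Partition.shiftPos i ∘ f) := by
  rintro ⟨j, r⟩
  dsimp only
  split_ifs with hr
  · have hj : 0 < j := Nat.zero_lt_of_lt hr
    -- Adding `(j - 1) * i` inverts adding `i` modulo `j` without subtracting positions, so the
    -- fibre over `(j, r)` after the shift is an old fibre.
    have hlt : (r + (j - 1) * i) % j < j := Nat.mod_lt _ hj
    rw [← (h (j, (r + (j - 1) * i) % j)).trans (if_pos hlt)]
    refine Fintype.card_congr (Equiv.subtypeEquivRight fun a => ?_)
    have ha := h.snd_lt_fst a
    have hji : (j - 1) * i + i = j * i := by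
      obtain ⟨k, rfl⟩ := Nat.exists_eq_succ_of_ne_zero hj.ne'
      simp [Nat.succ_mul]
    simp only [Function.comp]
    generalize f a = b at ha ⊢
    obtain ⟨j', s⟩ := b
    simp only [Nat.Partition.shiftPos, Prod.mk.injEq]
    refine and_congr_right ?_
    rintro rfl
    constructor
    · rintro rfl
      have : ((s + i) % j' + (j' - 1) * i) ≡ s [MOD j'] := by
        calc (s + i) % j' + (j' - 1) * i ≡ s + i + (j' - 1) * i [MOD j'] :=
              (Nat.mod_modEq _ _).add_right _
          _ = s + j' * i := by rw [← hji]; ring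
          _ ≡ s [MOD j'] := by simp [Nat.ModEq]
      exact (this.trans rfl).symm ▸ (Nat.mod_eq_of_lt ha).symm
    · rintro rfl
      have : (r + (j' - 1) * i) % j' + i ≡ r [MOD j'] := by
        calc (r + (j' - 1) * i) % j' + i ≡ r + (j' - 1) * i + i [MOD j'] :=
              (Nat.mod_modEq _ _).add_right _
          _ = r + j' * i := by rw [← hji]; ring
          _ ≡ r [MOD j'] := by simp [Nat.ModEq]
      exact Eq.trans this (Nat.mod_eq_of_lt hr)
  · rw [Fintype.card_eq_zero_iff]
    refine ⟨fun a => hr ?_⟩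
    obtain ⟨a, ha⟩ := a
    have := h.snd_lt_fst a
    simp only [Function.comp, Nat.Partition.shiftPos, Prod.mk.injEq] at ha
    obtain ⟨rfl, rfl⟩ := ha
    exact Nat.mod_lt _ (Nat.zero_lt_of_lt this)

end Nat.Partition

/-! ### Modes, their placements, and rotations of the block sequence -/

namespace BP

variable {n : ℕ}

/-- The o-block that contains `a`. -/
noncomputable def oBlock (μ : BP n) (a : Fin n) : List (Fin n) :=
  (μ.2.2 a).choose

theorem oBlock_mem (μ : BP n) (a : Fin n) : μ.oBlock a ∈ μ.1 :=
  (μ.2.2 a).choose_spec.1.1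

theorem mem_oBlock (μ : BP n) (a : Fin n) : a ∈ μ.oBlock a :=
  (μ.2.2 a).choose_spec.1.2

theorem eq_oBlock {μ : BP n} {a : Fin n} {S : List (Fin n)} (hS : S ∈ μ.1) (ha : a ∈ S) :
    S = μ.oBlock a :=
  (μ.2.2 a).unique ⟨hS, ha⟩ ⟨μ.oBlock_mem a, μ.mem_oBlock a⟩

/-- The size of the o-block that contains `a` and the position of `a` in it. -/
noncomputable def placement (μ : BP n) (a : Fin n) : ℕ × ℕ :=
  ((μ.oBlock a).length, (μ.oBlock a).idxOf a)

theorem placement_snd_lt_fst (μ : BP n) (a : Fin n) : (μ.placement a).2 < (μ.placement a).1 :=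
  List.idxOf_lt_length_iff.2 (μ.mem_oBlock a)

theorem placement_eq_iff {μ : BP n} {a : Fin n} {j r : ℕ} :
    μ.placement a = (j, r) ↔ ∃ S ∈ μ.1, S.length = j ∧ S[r]? = some a := by
  constructor
  · intro h
    obtain ⟨h1, h2⟩ := Prod.mk.injEq .. ▸ h
    refine ⟨_, μ.oBlock_mem a, h1, ?_⟩
    rw [← h2, List.getElem?_idxOf (μ.mem_oBlock a)]
  · rintro ⟨S, hS, rfl, hr⟩
    obtain ⟨hlt, rfl⟩ := List.getElem?_eq_some_iff.1 hr
    have h := eq_oBlock hS (List.getElem_mem hlt)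
    rw [placement, ← h, (μ.2.1 S hS).2.idxOf_getElem]

theorem mem_block_iff {μ : BP n} {a : Fin n} {t : ℕ} :
    a ∈ μ.block t ↔ t % (μ.placement a).1 = (μ.placement a).2 := by
  simp only [block, Finset.mem_filter, Finset.mem_univ, true_and]
  constructor
  · rintro ⟨S, hS, h⟩
    rw [placement_eq_iff.2 ⟨S, hS, rfl, h⟩]
  · intro h
    obtain ⟨S, hS, hl, hr⟩ := placement_eq_iff.1 (show μ.placement a = (_, _) from rfl)
    exact ⟨S, hS, by rw [hl]; exact (congrArg (S[·]?) h).trans hr⟩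

theorem numSubsteps_dvd_iff {μ : BP n} {k : ℕ} :
    μ.numSubsteps ∣ k ↔ ∀ a, (μ.placement a).1 ∣ k := by
  rw [numSubsteps, Finset.lcm_dvd_iff]
  constructor
  · exact fun h a => h _ (μ.oBlock_mem a)
  · intro h S hS
    obtain ⟨a, ha⟩ := List.exists_mem_of_ne_nil S (μ.2.1 S hS).1
    rw [eq_oBlock hS ha]
    exact h a

theorem numSubsteps_eq_lcmParts (μ : BP n) : μ.numSubsteps = μ.partition.lcmParts := by
  refine Nat.dvd_right_iff_eq.1 fun k => ?_
  rw [Nat.Partition.lcmParts_dvd_iff, numSubsteps, Finset.lcm_dvd_iff]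
  simp [partition]

theorem block_congr {μ : BP n} {s t : ℕ} (h : s ≡ t [MOD μ.numSubsteps]) :
    μ.block s = μ.block t := by
  ext a
  rw [mem_block_iff, mem_block_iff, h.of_dvd (numSubsteps_dvd_iff.1 dvd_rfl a)]

theorem phi_eq_rotate_iff {μ ν : BP n} {i : ℕ} :
    μ.phi = ν.phi.rotate i ↔ ∀ a, ν.placement a = Nat.Partition.shiftPos i (μ.placement a) := by
  have hget : μ.phi = ν.phi.rotate i ↔
      μ.numSubsteps = ν.numSubsteps ∧ ∀ t, μ.block t = ν.block (t + i) := by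
    constructor
    · intro h
      have hl : μ.numSubsteps = ν.numSubsteps := by
        simpa [length_phi] using congrArg List.length h
      refine ⟨hl, fun t => ?_⟩
      have ht : t % μ.numSubsteps < μ.numSubsteps := Nat.mod_lt _ μ.numSubsteps_pos
      have h1 := congrArg (fun l => l[t % μ.numSubsteps]?) h
      rw [List.getElem?_rotate (by rwa [length_phi, ← hl]), length_phi] at h1
      simp only [phi, List.getElem?_map, List.getElem?_range ht,
        List.getElem?_range (Nat.mod_lt _ ν.numSubsteps_pos), Option.map_some,
        Option.some_inj] at h1
      rw [block_congr (Nat.mod_modEq t _).symm, h1]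
      refine block_congr ((Nat.mod_modEq _ _).trans ?_)
      rw [hl]
      exact (Nat.mod_modEq _ _).add_right i
    · rintro ⟨hl, h⟩
      refine List.ext_getElem (by simp [length_phi, hl]) fun t ht _ => ?_
      rw [List.getElem_rotate]
      simp only [phi, List.getElem_map, List.getElem_range, List.length_map, List.length_range, h]
      exact block_congr (Nat.mod_modEq _ _).symm
  rw [hget]
  constructor
  · rintro ⟨-, h⟩ a
    -- The update times of `a` form one residue class for each mode. Testing the times `r`, `r + j`
    -- and `r + k` shows that the two periods divide each other.
    have hmod : ∀ t, t % (μ.placement a).1 = (μ.placement a).2 ↔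
        (t + i) % (ν.placement a).1 = (ν.placement a).2 := fun t => by
      rw [← mem_block_iff, ← mem_block_iff, h]
    have hμ := μ.placement_snd_lt_fst a
    have hν := ν.placement_snd_lt_fst a
    generalize μ.placement a = b at *
    generalize ν.placement a = c at *
    obtain ⟨j, r⟩ := b
    obtain ⟨k, s⟩ := c
    dsimp only at *
    have h0 : (r + i) % k = s := (hmod r).1 (Nat.mod_eq_of_lt hμ)
    have h1 : (r + j + i) % k = s := (hmod (r + j)).1 (by simpa using Nat.mod_eq_of_lt hμ)
    have h2 : (r + k) % j = r := (hmod (r + k)).2 (by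
      rw [← h0, add_right_comm, Nat.add_mod_right])
    have hkj : k ∣ j := by
      have : r + i + 0 ≡ r + i + j [MOD k] := by
        rw [add_right_comm r i j]
        exact h0.trans h1.symm
      exact (Nat.modEq_zero_iff_dvd.1 (Nat.ModEq.add_left_cancel' _ this).symm)
    have hjk : j ∣ k := by
      have : r + 0 ≡ r + k [MOD j] := (Nat.mod_eq_of_lt hμ).trans h2.symm
      exact (Nat.modEq_zero_iff_dvd.1 (Nat.ModEq.add_left_cancel' _ this).symm)
    obtain rfl := Nat.dvd_antisymm hjk hkj
    rw [Nat.Partition.shiftPos, h0]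
  · intro h
    constructor
    · refine Nat.dvd_right_iff_eq.1 fun k => ?_
      simp only [numSubsteps_dvd_iff, h, Nat.Partition.shiftPos]
    · intro t
      ext a
      rw [mem_block_iff, mem_block_iff, h]
      have hμ := μ.placement_snd_lt_fst a
      dsimp only [Nat.Partition.shiftPos]
      conv_lhs => rw [← Nat.mod_eq_of_lt hμ]
      exact ⟨fun e => Nat.ModEq.add_right i e, fun e => Nat.ModEq.add_right_cancel' i e⟩

theorem equiv₀_iff {μ ν : BP n} : Equiv₀ μ ν ↔ μ.placement = ν.placement := by
  have h := phi_eq_rotate_iff (μ := μ) (ν := ν) (i := 0)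
  rw [List.rotate_zero] at h
  rw [Equiv₀, h, funext_iff]
  refine forall_congr' fun a => ?_
  rw [Nat.Partition.shiftPos, add_zero, Nat.mod_eq_of_lt (μ.placement_snd_lt_fst a), eq_comm]

theorem isPlacement_placement (μ : BP n) : μ.partition.IsPlacement μ.placement := by
  rintro ⟨j, r⟩
  dsimp only
  split_ifs with hr
  · have h1 : μ.partition.mult j = (μ.1.filter fun S => S.length = j).card := by
      rw [Nat.Partition.mult, partition, Multiset.count_map, Finset.card, Finset.filter_val]
      simp only [eq_comm]
    rw [h1, Fintype.card_subtype]
    -- Each o-block of size `j` has exactly one automaton at position `r`, so `S ↦ S[r]` is the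
    -- inverse.
    refine Finset.card_bij (fun a _ => μ.oBlock a) ?_ ?_ ?_
    · intro a ha
      obtain ⟨-, ha⟩ := Finset.mem_filter.1 ha
      exact Finset.mem_filter.2 ⟨μ.oBlock_mem a, congrArg Prod.fst ha⟩
    · intro a ha b hb hab
      have ha := congrArg Prod.snd (Finset.mem_filter.1 ha).2
      have hb := congrArg Prod.snd (Finset.mem_filter.1 hb).2
      have ea := List.getElem?_idxOf (μ.mem_oBlock a)
      have eb := List.getElem?_idxOf (μ.mem_oBlock b)
      simp only [placement] at ha hb
      rw [ha, hab] at ea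
      rw [hb] at eb
      exact Option.some_inj.1 (ea.symm.trans eb)
    · intro S hS
      obtain ⟨hSμ, rfl⟩ := Finset.mem_filter.1 hS
      refine ⟨S[r], Finset.mem_filter.2 ⟨Finset.mem_univ _, placement_eq_iff.2
        ⟨S, hSμ, rfl, List.getElem?_eq_getElem hr⟩⟩, (eq_oBlock hSμ (List.getElem_mem hr)).symm⟩
  · rw [Fintype.card_eq_zero_iff]
    refine ⟨fun a => hr ?_⟩
    have := μ.placement_snd_lt_fst a.1
    rwa [a.2] at this

/-- Number each fibre over `(j, r)`, `r < j`, by `Fin (p.mult j)`; the `k`-th o-block of size `j`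
lists the `k`-th elements of the fibres over `(j, 0), …, (j, j - 1)`. The numberings are arbitrary:
other choices give `≡₀`-equivalent modes. -/
theorem exists_placement_eq {p : n.Partition} {f : Fin n → ℕ × ℕ} (h : p.IsPlacement f) :
    ∃ μ : BP n, μ.placement = f := by
  classical
  let e : ∀ j (r : Fin j), Fin (p.mult j) ≃ {a // f a = (j, r.1)} := fun j r =>
    Fintype.equivOfCardEq (by rw [Fintype.card_fin, h, if_pos r.2])
  let L : (Σ j : ℕ, Fin (p.mult j)) → List (Fin n) := fun x =>
    List.ofFn fun r : Fin x.1 => (e x.1 r x.2).1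
  have hL : ∀ x a, a ∈ L x ↔ ∃ r, ((e x.1 r x.2).1 : Fin n) = a := fun x a => by
    simp [L, List.mem_ofFn]
  have hmem : ∀ a, ∃ x, x.1 ∈ Finset.Icc 1 p.maxPart ∧ a ∈ L x := fun a => by
    let r : Fin (f a).1 := ⟨(f a).2, h.snd_lt_fst a⟩
    let k := (e (f a).1 r).symm ⟨a, rfl⟩
    refine ⟨⟨(f a).1, k⟩, ?_, (hL _ _).2 ⟨r, ?_⟩⟩
    · by_contra hj
      exact (Nat.Partition.mult_eq_zero hj ▸ k).elim0
    · simp [k]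
  have huniq : ∀ x y a, a ∈ L x → a ∈ L y → x = y := by
    rintro ⟨j, k⟩ ⟨j', k'⟩ a hx hy
    obtain ⟨r, hr⟩ := (hL _ _).1 hx
    obtain ⟨r', hr'⟩ := (hL _ _).1 hy
    dsimp only at r r' hr hr'
    have h1 := (hr ▸ (e j r k).2 : f a = (j, r.1))
    have h2 := (hr' ▸ (e j' r' k').2 : f a = (j', r'.1))
    obtain ⟨rfl, hrr⟩ := Prod.mk.injEq .. ▸ h1.symm.trans h2
    obtain rfl := Fin.ext hrr
    have : k = k' := (e j r).injective (Subtype.ext (hr.trans hr'.symm))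
    rw [this]
  let μ : Finset (List (Fin n)) :=
    ((Finset.Icc 1 p.maxPart).sigma fun j => (Finset.univ : Finset (Fin (p.mult j)))).image L
  have hμ : IsPartitionedOrder μ := by
    constructor
    · intro S hS
      obtain ⟨⟨j, k⟩, hx, rfl⟩ := Finset.mem_image.1 hS
      obtain ⟨hj, -⟩ := Finset.mem_sigma.1 hx
      constructor
      · refine List.ne_nil_of_length_pos ?_
        rw [List.length_ofFn]
        exact (Finset.mem_Icc.1 hj).1
      · refine List.nodup_ofFn.2 fun r r' hrr => ?_
        have h1 := (e j r k).2
        have h2 := (e j r' k).2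
        dsimp only at hrr
        rw [hrr] at h1
        exact Fin.ext (congrArg Prod.snd (h1.symm.trans h2))
    · intro a
      obtain ⟨x, hx, ha⟩ := hmem a
      refine ⟨L x, ⟨Finset.mem_image_of_mem L (Finset.mem_sigma.2 ⟨hx, Finset.mem_univ _⟩), ha⟩, ?_⟩
      rintro S ⟨hS, haS⟩
      obtain ⟨y, -, rfl⟩ := Finset.mem_image.1 hS
      rw [huniq x y a ha haS]
  refine ⟨⟨μ, hμ⟩, funext fun a => ?_⟩
  obtain ⟨x, hx, ha⟩ := hmem a
  obtain ⟨r, hr⟩ := (hL _ _).1 ha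
  have hfa : f a = (x.1, r.1) := hr ▸ (e x.1 r x.2).2
  rw [hfa]
  refine placement_eq_iff.2 ⟨L x, Finset.mem_image_of_mem L
    (Finset.mem_sigma.2 ⟨hx, Finset.mem_univ _⟩), by simp [L], ?_⟩
  simp [L, hr]

theorem EquivStar.partition_eq {μ ν : BP n} (h : EquivStar ν μ) : ν.partition = μ.partition := by
  obtain ⟨i, -, h⟩ := h
  have hs : μ.placement = Nat.Partition.shiftPos i ∘ ν.placement :=
    funext (phi_eq_rotate_iff.1 h)
  exact (hs ▸ ν.isPlacement_placement.shiftPos i).unique μ.isPlacement_placement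

/-- The classes are those of modes `ν i` realizing the placement of `μ` shifted by `i`, for `i`
below the number of substeps. They are distinct because a coincidence forces `i ≡ i'` modulo every
o-block size, hence modulo their lcm. -/
theorem card_toStar_fiber (μ : BP n) :
    Nat.card {c : BPZero n // c.toStar = μ.toStar} = μ.partition.lcmParts := by
  choose ν hν using fun i => exists_placement_eq (μ.isPlacement_placement.shiftPos i)
  have hstar : ∀ i, (ν i).toStar = μ.toStar := fun i => by
    refine Quotient.sound (s := setoidStar n) ((setoidStar n).symm ?_)
    refine (equivStar_iff_isRotated _ _).2 ⟨i, ?_⟩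
    exact (phi_eq_rotate_iff.2 fun a => congrFun (hν i) a).symm
  let F : Fin μ.numSubsteps → {c : BPZero n // c.toStar = μ.toStar} := fun i =>
    ⟨Quotient.mk (setoid₀ n) (ν i), hstar i⟩
  have hF : Function.Bijective F := by
    constructor
    · intro i i' h
      have h1 : Equiv₀ (ν i) (ν i') := Quotient.exact (s := setoid₀ n) (congrArg Subtype.val h)
      rw [equiv₀_iff, hν, hν] at h1
      have h2 : (i : ℕ) ≡ i' [MOD μ.numSubsteps] := by
        rw [Nat.modEq_iff_dvd, Int.natCast_dvd, numSubsteps_dvd_iff]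
        intro a
        rw [← Int.natCast_dvd, ← Nat.modEq_iff_dvd]
        exact Nat.ModEq.add_left_cancel' _ (congrArg Prod.snd (congrFun h1 a))
      exact Fin.ext (h2.eq_of_lt_of_lt i.2 i'.2)
    · rintro ⟨c, hc⟩
      induction c using Quotient.inductionOn (s := setoid₀ n) with | _ ξ
      -- This direction makes the placement of `ξ` a forward shift of that of `μ`, as for `ν i`.
      have h1 : EquivStar μ ξ := (setoidStar n).symm (Quotient.exact (s := setoidStar n) hc)
      obtain ⟨i, hi, h⟩ := h1
      have hl : ξ.phi.length = μ.numSubsteps := by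
        rw [← length_phi, h, List.length_rotate]
      refine ⟨⟨i, hl ▸ hi⟩, Subtype.ext (Quotient.sound (s := setoid₀ n) (equiv₀_iff.2 ?_))⟩
      rw [hν]
      exact (funext (phi_eq_rotate_iff.1 h)).symm
  rw [← Nat.card_congr (Equiv.ofBijective F hF), Nat.card_fin, numSubsteps_eq_lcmParts]

end BP

/-! ### Counting the classes of a given partition -/

/-- The integer partition from which the modes of a class of `BPStar n` are generated. -/
def BPStar.partition {n : ℕ} (s : BPStar n) : n.Partition :=
  Quotient.lift (s := BP.setoidStar n) BP.partition (fun _ _ h => BP.EquivStar.partition_eq h) s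

theorem card_bpZero_partition_eq {n : ℕ} (p : n.Partition) :
    Nat.card {c : BPZero n // c.toStar.partition = p} =
      Nat.card {f : Fin n → ℕ × ℕ // p.IsPlacement f} := by
  let P : BPZero n → Fin n → ℕ × ℕ :=
    Quotient.lift (s := BP.setoid₀ n) BP.placement fun _ _ h => BP.equiv₀_iff.1 h
  have hP : ∀ c : BPZero n, c.toStar.partition.IsPlacement (P c) := fun c => by
    induction c using Quotient.inductionOn (s := BP.setoid₀ n) with | _ μ
    exact μ.isPlacement_placement
  refine Nat.card_congr (Equiv.ofBijective
    (fun c => ⟨P c.1, by have h := hP c.1; rwa [c.2] at h⟩) ⟨fun c d h => ?_, fun f => ?_⟩)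
  · obtain ⟨c, hc⟩ := c
    obtain ⟨d, hd⟩ := d
    induction c using Quotient.inductionOn (s := BP.setoid₀ n) with | _ μ
    induction d using Quotient.inductionOn (s := BP.setoid₀ n) with | _ ν
    exact Subtype.ext (Quotient.sound (s := BP.setoid₀ n)
      (BP.equiv₀_iff.2 (congrArg Subtype.val h)))
  · obtain ⟨μ, hμ⟩ := BP.exists_placement_eq f.2
    refine ⟨⟨Quotient.mk (BP.setoid₀ n) μ, ?_⟩, Subtype.ext hμ⟩
    exact (hμ ▸ μ.isPlacement_placement).unique f.2

theorem finite_bpZero_partition_eq {n : ℕ} (p : n.Partition) :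
    Finite {c : BPZero n // c.toStar.partition = p} := by
  -- `Nat.card` is `0` on infinite types, whereas this cardinality divides `n !`.
  refine Nat.finite_of_card_ne_zero fun h => ?_
  have := p.card_isPlacement_mul
  rw [← card_bpZero_partition_eq, h, zero_mul] at this
  exact (Nat.factorial_ne_zero n) this.symm

theorem toStar_surjective (n : ℕ) : Function.Surjective (BPZero.toStar : BPZero n → BPStar n) := by
  intro s
  induction s using Quotient.inductionOn (s := BP.setoidStar n) with | _ μ
  exact ⟨Quotient.mk (BP.setoid₀ n) μ, rfl⟩

theorem finite_bpStar_partition_eq {n : ℕ} (p : n.Partition) :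
    Finite {s : BPStar n // s.partition = p} := by
  have := finite_bpZero_partition_eq p
  refine Finite.of_surjective
    (fun c : {c : BPZero n // c.toStar.partition = p} => (⟨c.1.toStar, c.2⟩ :
      {s : BPStar n // s.partition = p})) ?_
  rintro ⟨s, hs⟩
  obtain ⟨c, rfl⟩ := toStar_surjective n s
  exact ⟨⟨c, hs⟩, rfl⟩

/-- The `≡₀`-classes for `p` map onto the `≡⋆`-classes for `p`, with all fibres of size `lcm(p)` by
`card_toStar_fiber`. -/
theorem card_bpStar_partition_eq_mul {n : ℕ} (p : n.Partition) :
    Nat.card {s : BPStar n // s.partition = p} * p.lcmParts =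
      Nat.card {c : BPZero n // c.toStar.partition = p} := by
  have := finite_bpZero_partition_eq p
  have := finite_bpStar_partition_eq p
  have := Fintype.ofFinite {s : BPStar n // s.partition = p}
  let F : {c : BPZero n // c.toStar.partition = p} → {s : BPStar n // s.partition = p} :=
    fun c => ⟨c.1.toStar, c.2⟩
  have hfib : ∀ s, Nat.card {c // F c = s} = p.lcmParts := by
    rintro ⟨s, hs⟩
    induction s using Quotient.inductionOn (s := BP.setoidStar n) with | _ μ
    obtain rfl : μ.partition = p := hs
    rw [← μ.card_toStar_fiber]
    refine Nat.card_congr (Equiv.ofBijective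
      (fun c => ⟨c.1.1, congrArg Subtype.val c.2⟩) ⟨fun c d h => ?_, fun c => ?_⟩)
    · have h1 : c.1.1 = d.1.1 := congrArg (fun x => x.1) h
      exact Subtype.ext (Subtype.ext h1)
    · exact ⟨⟨⟨c.1, congrArg BPStar.partition c.2⟩, Subtype.ext c.2⟩, rfl⟩
  rw [← Nat.card_congr (Equiv.sigmaFiberEquiv F), Nat.card_sigma]
  simp [hfib]

theorem mainTheorem10 (n : ℕ) (hn : 1 ≤ n) :
    ((Nat.card (BPStar n) : ℚ) =
      ∑ p : n.Partition,
        (n ! : ℚ) / (∏ j ∈ Finset.Icc 1 p.maxPart, ((p.mult j)! : ℚ) ^ j) *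
          (1 / (p.lcmParts : ℚ))) ∧
    ∀ μ : BP n,
      (∀ ν : BP n, BP.EquivStar ν μ → ν.partition = μ.partition) ∧
      Nat.card {c : BPZero n // c.toStar = μ.toStar} = μ.partition.lcmParts := by
  refine ⟨?_, fun μ => ⟨fun ν h => h.partition_eq, μ.card_toStar_fiber⟩⟩
  have := fun p : n.Partition => finite_bpStar_partition_eq p
  rw [← Nat.card_congr (Equiv.sigmaFiberEquiv (BPStar.partition : BPStar n → _)), Nat.card_sigma,
    Nat.cast_sum]
  refine Finset.sum_congr rfl fun p _ => ?_
  have h : Nat.card {s : BPStar n // s.partition = p} * p.lcmParts *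
      ∏ j ∈ Finset.Icc 1 p.maxPart, (p.mult j)! ^ j = n ! := by
    rw [card_bpStar_partition_eq_mul, card_bpZero_partition_eq, p.card_isPlacement_mul]
  have hne := Nat.factorial_ne_zero n
  -- Once `n !` is replaced by the product, its nonvanishing makes both denominators nonzero.
  rw [← h] at hne ⊢
  have h1 : (p.lcmParts : ℚ) ≠ 0 := by
    exact_mod_cast right_ne_zero_of_mul (left_ne_zero_of_mul hne)
  have h2 : (∏ j ∈ Finset.Icc 1 p.maxPart, ((p.mult j)! : ℚ) ^ j) ≠ 0 := by
    exact_mod_cast right_ne_zero_of_mul hne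
  push_cast
  field_simp
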